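/- Conventions. Let $N\ge 1$ and let $1\le k\le N$ be integers. $\mathrm{Gr}(k,N)$ denotes the Grassmannian of $k$-dimensional linear subspaces of $\mathbb R^N$ with its rotation-invariant Borel probability measure $\gamma_{k,N}$, that is, the law of $g(\mathbb R^k\times\{0\})$ for $g\in O(N)$ chosen according to the Haar probability measure. "Almost every $V$" means $\gamma_{k,N}$-almost every $V\in\mathrm{Gr}(k,N)$. For $V\in \mathrm{Gr}(k,N)$ let $P_V\colon\mathbb R^N\to V$ be the orthogonal projection. For a bounded set $Y\subset\mathbb R^N$ and $\delta>0$ let $N(Y,\delta)$ be the minimal number of balls of radius $\delta$ needed to cover $Y$. Let $\dim_H$ be the Hausdorff dimension, let $$\overline{\dim}_B\,X=\limsup_{\delta\to0^+}\frac{\log N(X,\delta)}{-\log\delta},$$ and let the Assouad dimension $\dim_A X$ be the infimum of all $s>0$ for which there is $M>0$ such that $N(X\cap B(x,r),\rho)\le M(r/\rho)^s$ for all $x\in X$ and $0<\rho<r$. A map $f\colon A\to\mathbb R^N$ on a set $A$ in a Euclidean space is pointwise $\alpha$-Hölder if for every $x\in A$ there is $c_x>0$ such that $\|f(x)-f(y)\|\le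 c_x\|x-y\|^\alpha$ for all $y\in A$. Theorem. Let $X\subset\mathbb R^N$ be compact and let $\mu$ be a finite Borel measure supported on $X$, i.e. $\mu(\mathbb R^N\setminus X)=0$. (i) If $\dim_H X<k$, then for almost every $V$ there is a Borel set $X_V\subset X$ of full $\mu$-measure such that $P_V|_{X_V}$ is injective and its inverse $P_V(X_V)\to X_V$ is continuous. (ii) If $\overline{\dim}_B\,X<k$, then for almost every $V$ there is a Borel set $X_V\subset X$ of full $\mu$-measure such that $P_V|_{X_V}$ is injective and its inverse $P_V(X_V)\to X_V$ is pointwise $\alpha$-Hölder for every $\alpha\in\big(0,\,1-\overline{\dim}_B\,X/k\big)$. (iii) If $\dim_A X<k$, then for almost every $V$ there is a Borel set $X_V\subset X$ of full $\mu$-measure such that $P_V|_{X_V}$ is injective and its inverse $P_V(X_V)\to X_V$ is pointwise $\alpha$-Hölder for every $\alpha\in(0,1)$. -/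

import Mathlib

open MeasureTheory Filter Topology Set
open scoped NNReal ENNReal

/-! ### Dimensions -/

namespace Dimension

variable {Z : Type*} [PseudoMetricSpace Z]

/-- The upper box-counting (Minkowski) dimension
`limsup_{δ → 0⁺} log N(X, δ) / (- log δ)` of a set `X`, where `N(X, δ)` is the minimal number of
closed balls of radius `δ` needed to cover `X`. It takes values in the extended reals; it is
`⊥` for `X = ∅`, because `log 0 = ⊥`, and non-negative for `X ≠ ∅`. -/
noncomputable def upperBoxDim (X : Set Z) : EReal :=
  limsup (fun δ : ℝ≥0 =>
      ENNReal.log ((Metric.externalCoveringNumber δ X : ℕ∞) : ℝ≥0∞) / ((-Real.log δ : ℝ) : EReal))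
    (𝓝[>] 0)

/-- A set `X` is `(M, s)`-homogeneous if for all `x ∈ X` and `0 < ρ < r`, the set `X ∩ B(x, r)`
can be covered by at most `M (r / ρ) ^ s` balls of radius `ρ`. -/
def IsHomogeneous (M s : ℝ≥0) (X : Set Z) : Prop :=
  ∀ x ∈ X, ∀ r ρ : ℝ≥0, 0 < ρ → ρ < r →
    ((Metric.externalCoveringNumber ρ (X ∩ Metric.closedBall x r) : ℕ∞) : ℝ≥0∞)
      ≤ ((M * (r / ρ) ^ (s : ℝ) : ℝ≥0) : ℝ≥0∞)

/-- The Assouad dimension: the infimum of all `s > 0` such that `X` is `(M, s)`-homogeneous for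
some `M > 0`. -/
noncomputable def assouadDim (X : Set Z) : ℝ≥0∞ :=
  ⨅ (s : ℝ≥0) (_ : 0 < s ∧ ∃ M : ℝ≥0, 0 < M ∧ IsHomogeneous M s X), (s : ℝ≥0∞)

end Dimension

/-- A map `f`, considered on the set `A`, is pointwise `α`-Hölder if for every `x ∈ A` there is
`c > 0` such that `dist (f x) (f y) ≤ c * dist x y ^ α` for every `y ∈ A`. -/
def PointwiseHolderOn {Y Z : Type*} [PseudoMetricSpace Y] [PseudoMetricSpace Z]
    (α : ℝ) (f : Y → Z) (A : Set Y) : Prop :=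
  ∀ x ∈ A, ∃ c : ℝ, 0 < c ∧ ∀ y ∈ A, dist (f x) (f y) ≤ c * dist x y ^ α

/-! ### The orthogonal group -/

/-- The orthogonal group `O(N)`: the linear operators `g` of `ℝ^N` with `g* g = g g* = 1`, with the
operator norm topology. -/
abbrev OrthogonalGroup (N : ℕ) : Type :=
  unitary (EuclideanSpace ℝ (Fin N) →L[ℝ] EuclideanSpace ℝ (Fin N))

namespace OrthogonalGroup

instance instContinuousStar (N : ℕ) :
    ContinuousStar (EuclideanSpace ℝ (Fin N) →L[ℝ] EuclideanSpace ℝ (Fin N)) :=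
  ⟨(ContinuousLinearMap.adjoint (𝕜 := ℝ) (E := EuclideanSpace ℝ (Fin N))
    (F := EuclideanSpace ℝ (Fin N))).continuous⟩

instance instIsTopologicalGroup (N : ℕ) : IsTopologicalGroup (OrthogonalGroup N) where
  continuous_inv := Continuous.subtype_mk (continuous_star.comp continuous_subtype_val) _

instance instCompactSpace (N : ℕ) : CompactSpace (OrthogonalGroup N) := by
  refine isCompact_iff_compactSpace.mp ?_
  refine Metric.isCompact_of_isClosed_isBounded isClosed_unitary ?_
  refine (Metric.isBounded_closedBall (x := 0) (r := 1)).subset fun g hg => ?_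
  rw [mem_closedBall_zero_iff]
  refine ContinuousLinearMap.opNorm_le_bound _ zero_le_one fun x => ?_
  rw [one_mul]
  exact (Unitary.norm_map ⟨g, hg⟩ x).le

/-- The Haar probability measure on `O(N)`. -/
noncomputable def haar (N : ℕ) : Measure (OrthogonalGroup N) := Measure.haarMeasure ⊤

end OrthogonalGroup

/-! ### The Grassmannian and its rotation-invariant measure -/

/-- The Grassmannian `Gr(k, N)` of `k`-dimensional linear subspaces of `ℝ^N`. -/
def Gr (k N : ℕ) : Type :=
  {V : Submodule ℝ (EuclideanSpace ℝ (Fin N)) // Module.finrank ℝ V = k}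

namespace Gr

variable {k N : ℕ}

/-- The orthogonal projection `P_V : ℝ^N → V`. -/
noncomputable def proj (V : Gr k N) : EuclideanSpace ℝ (Fin N) →L[ℝ] V.1 :=
  V.1.orthogonalProjectionOnto

/-- The topology of `Gr(k, N)`, given by the metric `‖P_V - P_W‖` (here the projections are
regarded as operators of `ℝ^N`). -/
noncomputable instance instTopologicalSpace : TopologicalSpace (Gr k N) :=
  TopologicalSpace.induced (fun V => V.1.starProjection) inferInstance

noncomputable instance instMeasurableSpace : MeasurableSpace (Gr k N) := borel _

instance instBorelSpace : BorelSpace (Gr k N) := ⟨rfl⟩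

/-- The image `g V` of a subspace `V` under `g ∈ O(N)`. -/
noncomputable def rotate (g : OrthogonalGroup N) (V : Gr k N) : Gr k N :=
  ⟨V.1.map (Unitary.linearIsometryEquiv g).toLinearEquiv.toLinearMap, by
    rw [LinearEquiv.finrank_map_eq]; exact V.2⟩

/-- The coordinate subspace `ℝ^k × {0} ⊆ ℝ^N`. -/
noncomputable def coordinateSubspace (h : k ≤ N) : Gr k N :=
  ⟨Submodule.span ℝ (Set.range fun i : Fin k => EuclideanSpace.single (Fin.castLE h i) (1 : ℝ)), by
    have hli : LinearIndependent ℝ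
        (fun i : Fin k => EuclideanSpace.single (Fin.castLE h i) (1 : ℝ)) := by
      have := (EuclideanSpace.basisFun (Fin N) ℝ).orthonormal.linearIndependent.comp
        (Fin.castLE h) (Fin.castLE_injective h)
      have he : (fun i : Fin k => EuclideanSpace.single (Fin.castLE h i) (1 : ℝ)) =
          (EuclideanSpace.basisFun (Fin N) ℝ) ∘ Fin.castLE h := by
        funext i
        simp
      rw [he]
      exact this
    rw [finrank_span_eq_card hli, Fintype.card_fin]⟩

/-- The rotation-invariant measure `γ_{k,N}` on `Gr(k, N)`: the law of `g (ℝ^k × {0})`, where `g` is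
distributed according to the Haar probability measure on `O(N)`. -/
noncomputable def gamma (h : k ≤ N) : Measure (Gr k N) :=
  (OrthogonalGroup.haar N).map fun g => rotate g (coordinateSubspace h)

/-! The following facts show that `γ_{k,N}` is indeed a rotation-invariant probability measure. -/

theorem starProjection_rotate (g : OrthogonalGroup N) (V : Gr k N) :
    (rotate g V).1.starProjection = g.1 * V.1.starProjection * (g⁻¹).1 := by
  ext1 x
  exact Submodule.starProjection_map_apply (Unitary.linearIsometryEquiv g) V.1 x

theorem continuous_rotate_left (V : Gr k N) :
    Continuous fun g : OrthogonalGroup N => rotate g V := by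
  rw [continuous_induced_rng]
  have : ((fun W : Gr k N => W.1.starProjection) ∘ fun g : OrthogonalGroup N => rotate g V) =
      fun g => g.1 * V.1.starProjection * (g⁻¹).1 := funext fun g => starProjection_rotate g V
  rw [this]
  exact (continuous_subtype_val.mul continuous_const).mul
    (continuous_subtype_val.comp continuous_inv)

theorem continuous_rotate (g : OrthogonalGroup N) :
    Continuous fun V : Gr k N => rotate g V := by
  rw [continuous_induced_rng]
  have : ((fun W : Gr k N => W.1.starProjection) ∘ fun V : Gr k N => rotate g V) =
      fun V => g.1 * V.1.starProjection * (g⁻¹).1 := funext fun V => starProjection_rotate g V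
  rw [this]
  exact (continuous_const.mul continuous_induced_dom).mul continuous_const

theorem rotate_mul (g g' : OrthogonalGroup N) (V : Gr k N) :
    rotate (g * g') V = rotate g (rotate g' V) := by
  apply Subtype.ext
  simp only [rotate, ← Submodule.map_comp]
  rfl

instance isProbabilityMeasure_gamma (h : k ≤ N) : IsProbabilityMeasure (gamma h) := by
  have : IsProbabilityMeasure (OrthogonalGroup.haar N) :=
    ⟨Measure.haarMeasure_self (K₀ := (⊤ : TopologicalSpace.PositiveCompacts (OrthogonalGroup N)))⟩
  exact Measure.isProbabilityMeasure_map
    (continuous_rotate_left (coordinateSubspace h)).measurable.aemeasurable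

theorem map_rotate_gamma (h : k ≤ N) (g : OrthogonalGroup N) :
    (gamma h).map (rotate g) = gamma h := by
  have hm := (continuous_rotate_left (coordinateSubspace h)).measurable
  unfold gamma
  rw [Measure.map_map (continuous_rotate g).measurable hm]
  conv_rhs => rw [OrthogonalGroup.haar, ← map_mul_left_eq_self (Measure.haarMeasure ⊤) g]
  rw [Measure.map_map hm (continuous_const_mul g).measurable, OrthogonalGroup.haar]
  congr 1
  funext g'
  exact (rotate_mul g g' _).symm

end Gr

/-!
The proof rests on a small-ball estimate (`Gr.gamma_norm_proj_le`): for a fixed vector `z` with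
`‖z‖ ≥ r`, the probability that `‖P_V z‖ ≤ ε` is at most `C (ε / r) ^ k`. By rotation invariance
this probability, for `ε = t ‖z‖`, does not depend on `z ≠ 0`, so it may be averaged over the unit
ball; after exchanging the integrals, the invariance of Lebesgue measure leaves the volume of the
part of the unit ball on which the first `k` coordinates are at most `t`, which is `O(t ^ k)`.

Now fix `x ∈ X`. A cover of `X` by sets `t i` bounds the probability that the fibre of `P_V` through
`x` meets `X` at distance at least `r` from `x` by a multiple of `∑ (diam (t i) / r) ^ k`. Covers
making this sum arbitrarily small exist if `dim_H X < k`, and also if `N(X, ρ) = O(ρ ^ (-s))` with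
`s < k`; so almost surely no other point of `X` lies in the fibre of `x`. For the Hölder bound, cover
`X ∩ B(x, r)` by balls of radius `r ^ (1 / α)`: the probability that
`‖P_V (x - y)‖ ≤ r ^ (1 / α)` for some `y ∈ X` with `r / 2 ≤ ‖x - y‖ ≤ r` is at most a multiple of
`N(X ∩ B(x, r), r ^ (1 / α)) * r ^ (k (1 / α - 1))`. With the bounds on covering numbers provided by
the box dimension `d` if `α < 1 - d / k`, and by the Assouad dimension if `α < 1`, this is
summable over `r = 2 ^ (-n)`, and the Borel–Cantelli lemma applies
(`Gr.ae_exists_dist_le_mul_norm_proj_rpow`).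

These statements hold for each `x ∈ X` and almost every `V`. The set of pairs `(x, V)` in question
is Borel once it is written in terms of countably many constants and exponents, so Fubini's theorem
gives, for almost every `V`, a Borel set of full measure of points `x ∈ X` at which the inverse is
controlled against all points of `X` (`Gr.ae_exists_measurableSet_subset`).
-/

/-! ### Projections to a random subspace: the small-ball estimate -/

namespace Gr

variable {k N : ℕ}

theorem norm_proj (V : Gr k N) (z : EuclideanSpace ℝ (Fin N)) :
    ‖V.proj z‖ = ‖V.1.starProjection z‖ := by
  rw [Submodule.starProjection_apply, Submodule.coe_norm]
  rfl

theorem norm_proj_le (V : Gr k N) (z : EuclideanSpace ℝ (Fin N)) : ‖V.proj z‖ ≤ ‖z‖ := by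
  rw [norm_proj]
  exact V.1.norm_starProjection_apply_le z

theorem norm_proj_rotate (g : OrthogonalGroup N) (V : Gr k N) (z : EuclideanSpace ℝ (Fin N)) :
    ‖(rotate g V).proj z‖ = ‖V.proj ((Unitary.linearIsometryEquiv g).symm z)‖ := by
  rw [norm_proj, norm_proj]
  have h := Submodule.starProjection_map_apply (Unitary.linearIsometryEquiv g) V.1 z
  exact (congrArg norm h).trans ((Unitary.linearIsometryEquiv g).norm_map _)

theorem continuous_norm_proj :
    Continuous fun p : EuclideanSpace ℝ (Fin N) × Gr k N => ‖p.2.proj p.1‖ := by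
  simp only [norm_proj]
  have h : Continuous fun V : Gr k N => V.1.starProjection := continuous_induced_dom
  exact ((h.comp continuous_snd).clm_apply continuous_fst).norm

theorem continuous_norm_proj_right (z : EuclideanSpace ℝ (Fin N)) :
    Continuous fun V : Gr k N => ‖V.proj z‖ := by
  simp only [norm_proj]
  have h : Continuous fun V : Gr k N => V.1.starProjection := continuous_induced_dom
  exact (h.clm_apply continuous_const).norm

instance instSecondCountableTopology : SecondCountableTopology (Gr k N) := by
  have : SecondCountableTopology
      (EuclideanSpace ℝ (Fin N) →L[ℝ] EuclideanSpace ℝ (Fin N)) :=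
    have := FiniteDimensional.proper ℝ
      (EuclideanSpace ℝ (Fin N) →L[ℝ] EuclideanSpace ℝ (Fin N))
    secondCountable_of_proper
  exact IsInducing.secondCountableTopology (f := fun V : Gr k N => V.1.starProjection) ⟨rfl⟩

/-- `O(N)` acts transitively on spheres: a reflection interchanges two vectors of equal norm. -/
theorem exists_orthogonal_apply_eq {u v : EuclideanSpace ℝ (Fin N)} (h : ‖u‖ = ‖v‖) :
    ∃ g : OrthogonalGroup N, Unitary.linearIsometryEquiv g u = v :=
  ⟨Unitary.linearIsometryEquiv.symm (ℝ ∙ (u - v))ᗮ.reflection, by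
    rw [MulEquiv.apply_symm_apply]; exact Submodule.reflection_sub h⟩

/-- By rotation invariance, the probability that the projection shrinks a vector below a given
fraction of its length is the same for all non-zero vectors. -/
theorem gamma_norm_proj_le_mul_norm_eq (h : k ≤ N) (t : ℝ) {u v : EuclideanSpace ℝ (Fin N)}
    (hu : u ≠ 0) (hv : v ≠ 0) :
    gamma h {V | ‖V.proj u‖ ≤ t * ‖u‖} = gamma h {V | ‖V.proj v‖ ≤ t * ‖v‖} := by
  have hu' : 0 < ‖u‖ := norm_pos_iff.2 hu
  have hv' : 0 < ‖v‖ := norm_pos_iff.2 hv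
  obtain ⟨g, hg⟩ := exists_orthogonal_apply_eq (u := (‖v‖ / ‖u‖) • u) (v := v) (by
    rw [norm_smul, norm_div, norm_norm, norm_norm, div_mul_cancel₀ _ hu'.ne'])
  conv_rhs => rw [← map_rotate_gamma h g]
  rw [Measure.map_apply (continuous_rotate g).measurable
    (isClosed_le (continuous_norm_proj_right v) continuous_const).measurableSet]
  congr 1
  ext V
  simp only [mem_ofPred_eq, mem_preimage]
  rw [norm_proj_rotate, ← hg, LinearIsometryEquiv.symm_apply_apply, map_smul,
    LinearIsometryEquiv.norm_map, norm_smul, norm_smul, norm_div, norm_norm, norm_norm,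
    mul_left_comm, mul_le_mul_iff_right₀ (by positivity)]

theorem abs_le_norm_proj_coordinateSubspace (h : k ≤ N) (z : EuclideanSpace ℝ (Fin N))
    (i : Fin k) : |z (Fin.castLE h i)| ≤ ‖(coordinateSubspace h).proj z‖ := by
  set e : EuclideanSpace ℝ (Fin N) := EuclideanSpace.single (Fin.castLE h i) (1 : ℝ) with he
  have hmem : e ∈ (coordinateSubspace h).1 := Submodule.subset_span ⟨i, rfl⟩
  have h1 : z (Fin.castLE h i) = inner ℝ e z := by
    simp [he, EuclideanSpace.inner_single_left]
  have h2 : inner ℝ e z = inner ℝ e ((coordinateSubspace h).1.starProjection z) := by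
    rw [← Submodule.inner_starProjection_left_eq_right,
      Submodule.starProjection_eq_self_iff.2 hmem]
  rw [norm_proj, h1, h2]
  refine (abs_real_inner_le_norm _ _).trans (le_of_eq ?_)
  simp [he]

/-- The part of the unit ball on which the projection to the coordinate subspace is small lies in
a box with `k` short sides. -/
theorem volume_norm_proj_coordinateSubspace_le (h : k ≤ N) {t : ℝ} :
    volume {z : EuclideanSpace ℝ (Fin N) | ‖z‖ ≤ 1 ∧ ‖(coordinateSubspace h).proj z‖ ≤ t} ≤
      2 ^ N * ENNReal.ofReal t ^ k := by
  set c : Fin N → ℝ := fun j => if (j : ℕ) < k then t else 1 with hc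
  have hsub : {z : EuclideanSpace ℝ (Fin N) | ‖z‖ ≤ 1 ∧ ‖(coordinateSubspace h).proj z‖ ≤ t} ⊆
      (MeasurableEquiv.toLp 2 (Fin N → ℝ)).symm ⁻¹' Set.pi univ fun j => Icc (-c j) (c j) := by
    rintro z ⟨hz1, hz2⟩ j -
    change z j ∈ Icc (-c j) (c j)
    rw [mem_Icc, ← abs_le]
    by_cases hj : (j : ℕ) < k
    · simp only [hc, hj, if_true]
      exact (abs_le_norm_proj_coordinateSubspace h z ⟨j, hj⟩).trans hz2
    · simp only [hc, hj, if_false]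
      exact (PiLp.norm_apply_le z j).trans hz1
  refine (measure_mono hsub).trans ?_
  rw [(PiLp.volume_preserving_ofLp (Fin N)).measure_preimage_equiv, volume_pi_pi]
  have hprod : ∀ j : Fin N, volume (Icc (-c j) (c j)) =
      2 * if (j : ℕ) < k then ENNReal.ofReal t else 1 := by
    intro j
    rw [Real.volume_Icc, show c j - -c j = 2 * c j by ring, ENNReal.ofReal_mul zero_le_two]
    simp only [hc]
    split_ifs <;> simp
  rw [Finset.prod_congr rfl fun j _ => hprod j, Finset.prod_mul_distrib, Finset.prod_const,
    Finset.card_univ, Fintype.card_fin, Finset.prod_ite, Finset.prod_const, Finset.prod_const_one,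
    mul_one]
  have hcard : (Finset.univ.filter fun j : Fin N => (j : ℕ) < k).card = k := by
    rw [Fin.card_filter_val_lt, min_eq_right h]
  rw [hcard]

/-- The constant in the small-ball estimate `gamma_norm_proj_le`. -/
noncomputable def smallBallConst (N : ℕ) : ℝ≥0∞ :=
  2 ^ N / volume (Metric.closedBall (0 : EuclideanSpace ℝ (Fin N)) 1)

theorem smallBallConst_ne_top (N : ℕ) : smallBallConst N ≠ ⊤ :=
  ENNReal.div_ne_top (by simp) (Metric.measure_closedBall_pos _ _ one_pos).ne'

/-- Averaging the left-hand side over the unit ball and exchanging the order of integration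
reduces the estimate to a volume bound for a single subspace. -/
theorem gamma_norm_proj_le_mul_norm (h : k ≤ N) {t : ℝ} (ht : 0 ≤ t)
    {z : EuclideanSpace ℝ (Fin N)} (hz : z ≠ 0) :
    gamma h {V | ‖V.proj z‖ ≤ t * ‖z‖} ≤ smallBallConst N * ENNReal.ofReal t ^ k := by
  set B : Set (EuclideanSpace ℝ (Fin N)) := Metric.closedBall 0 1 with hB
  have hB0 : volume B ≠ 0 := (Metric.measure_closedBall_pos _ _ one_pos).ne'
  have hBtop : volume B ≠ ⊤ := measure_closedBall_lt_top.ne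
  set T : Set (EuclideanSpace ℝ (Fin N) × Gr k N) := {p | ‖p.2.proj p.1‖ ≤ t * ‖p.1‖} with hT
  have hTm : MeasurableSet T :=
    (isClosed_le continuous_norm_proj (continuous_const.mul continuous_fst.norm)).measurableSet
  have key : gamma h {V | ‖V.proj z‖ ≤ t * ‖z‖} * volume B ≤ 2 ^ N * ENNReal.ofReal t ^ k := by
    have h0 : ∀ᵐ u ∂(volume.restrict B), gamma h (Prod.mk u ⁻¹' T) =
        gamma h {V | ‖V.proj z‖ ≤ t * ‖z‖} := by
      have : Nontrivial (EuclideanSpace ℝ (Fin N)) := ⟨z, 0, hz⟩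
      filter_upwards [ae_restrict_of_ae (Measure.ae_ne volume 0)] with u hu
      exact gamma_norm_proj_le_mul_norm_eq h t hu hz
    calc gamma h {V | ‖V.proj z‖ ≤ t * ‖z‖} * volume B
        = ∫⁻ u, gamma h (Prod.mk u ⁻¹' T) ∂(volume.restrict B) := by
          rw [lintegral_congr_ae h0, lintegral_const, Measure.restrict_apply_univ]
      _ = ∫⁻ V, volume.restrict B ((fun u => (u, V)) ⁻¹' T) ∂(gamma h) := by
          rw [← Measure.prod_apply hTm, Measure.prod_apply_symm hTm]
      _ = ∫⁻ g, volume.restrict B ((fun u => (u, rotate g (coordinateSubspace h))) ⁻¹' T)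
            ∂(OrthogonalGroup.haar N) := by
          rw [gamma, lintegral_map (measurable_measure_prodMk_right hTm)
            (continuous_rotate_left _).measurable]
      _ ≤ ∫⁻ _, 2 ^ N * ENNReal.ofReal t ^ k ∂(OrthogonalGroup.haar N) := by
          refine lintegral_mono fun g => ?_
          rw [Measure.restrict_apply (measurable_prodMk_right hTm)]
          refine le_trans ?_ (volume_norm_proj_coordinateSubspace_le h)
          rw [← (Unitary.linearIsometryEquiv g).measurePreserving.measure_preimage_equiv
            (f := (Unitary.linearIsometryEquiv g).toHomeomorph.toMeasurableEquiv)]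
          refine measure_mono ?_
          rintro u ⟨hu1, hu2⟩
          have hg : ‖Unitary.linearIsometryEquiv g u‖ = ‖u‖ := LinearIsometryEquiv.norm_map _ u
          have hu3 : ‖u‖ ≤ 1 := hg ▸ mem_closedBall_zero_iff.1 hu2
          have hu4 : ‖(rotate g (coordinateSubspace h)).proj (Unitary.linearIsometryEquiv g u)‖ ≤
            t * ‖Unitary.linearIsometryEquiv g u‖ := hu1
          rw [norm_proj_rotate, LinearIsometryEquiv.symm_apply_apply, hg] at hu4
          exact ⟨hu3, hu4.trans (mul_le_of_le_one_right ht hu3)⟩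
      _ = 2 ^ N * ENNReal.ofReal t ^ k := by
          have : IsProbabilityMeasure (OrthogonalGroup.haar N) :=
            ⟨Measure.haarMeasure_self
              (K₀ := (⊤ : TopologicalSpace.PositiveCompacts (OrthogonalGroup N)))⟩
          rw [lintegral_const, measure_univ, mul_one]
  rw [smallBallConst, ENNReal.div_eq_inv_mul, mul_assoc, ← ENNReal.div_eq_inv_mul,
    ENNReal.le_div_iff_mul_le (Or.inl hB0) (Or.inl hBtop)]
  exact key

/-- The small-ball estimate for random projections: a vector of length at least `r` is projected
to one of length at most `ε` with probability `O((ε / r) ^ k)`. -/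
theorem gamma_norm_proj_le (h : k ≤ N) {ε r : ℝ} (hε : 0 ≤ ε) (hr : 0 < r)
    {z : EuclideanSpace ℝ (Fin N)} (hz : r ≤ ‖z‖) :
    gamma h {V | ‖V.proj z‖ ≤ ε} ≤ smallBallConst N * ENNReal.ofReal (ε / r) ^ k := by
  refine le_trans (measure_mono fun V hV => ?_)
    (gamma_norm_proj_le_mul_norm h (div_nonneg hε hr.le) (norm_pos_iff.1 (hr.trans_le hz)))
  have hV' : ‖V.proj z‖ ≤ ε := hV
  refine hV'.trans ?_
  rw [div_mul_eq_mul_div, le_div_iff₀ hr]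
  exact mul_le_mul_of_nonneg_left hz hε

end Gr

/-! ### Covering arguments -/

namespace Gr

variable {k N : ℕ}

/-- The part of a set of diameter at most `D` at distance at least `r` from `x` meets the
`ρ`-neighbourhood of the fibre through `x` with probability `O(((ρ + D) / r) ^ k)`. -/
theorem gamma_exists_mem_norm_proj_le (h : k ≤ N) {x : EuclideanSpace ℝ (Fin N)}
    {t : Set (EuclideanSpace ℝ (Fin N))} {D ρ r : ℝ} (hD : 0 ≤ D)
    (ht : ∀ y ∈ t, ∀ y' ∈ t, dist y y' ≤ D) (hρ : 0 ≤ ρ) (hr : 0 < r) :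
    gamma h {V | ∃ y ∈ t, r ≤ dist x y ∧ ‖V.proj (x - y)‖ ≤ ρ} ≤
      smallBallConst N * ENNReal.ofReal ((ρ + D) / r) ^ k := by
  by_cases hne : ∃ y ∈ t, r ≤ dist x y
  · obtain ⟨y₀, hy₀, hxy₀⟩ := hne
    refine le_trans (measure_mono ?_) (gamma_norm_proj_le h (add_nonneg hρ hD) hr
      (z := x - y₀) (by rwa [← dist_eq_norm]))
    rintro V ⟨y, hy, -, hV⟩
    have h1 : V.proj (x - y₀) = V.proj (x - y) + V.proj (y - y₀) := by
      rw [← map_add, sub_add_sub_cancel]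
    have h2 : ‖V.proj (y - y₀)‖ ≤ D :=
      (V.norm_proj_le _).trans (dist_eq_norm y y₀ ▸ ht y hy y₀ hy₀)
    change ‖V.proj (x - y₀)‖ ≤ ρ + D
    rw [h1]
    exact (norm_add_le _ _).trans (add_le_add hV h2)
  · have : {V : Gr k N | ∃ y ∈ t, r ≤ dist x y ∧ ‖V.proj (x - y)‖ ≤ ρ} = ∅ := by
      ext V
      simp only [mem_ofPred_eq, mem_empty_iff_false, iff_false]
      rintro ⟨y, hy, hxy, -⟩
      exact hne ⟨y, hy, hxy⟩
    rw [this, measure_empty]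
    exact zero_le

end Gr

/-- A finite covering number is attained by a finite cover. -/
theorem exists_finset_isCover {Z : Type*} [PseudoEMetricSpace Z] {ρ : ℝ≥0} {A : Set Z}
    (h : Metric.externalCoveringNumber ρ A ≠ ⊤) :
    ∃ C : Finset Z, Metric.IsCover ρ A C ∧
      (C.card : ℕ∞) ≤ Metric.externalCoveringNumber ρ A := by
  have h1 : Metric.externalCoveringNumber ρ A < Metric.externalCoveringNumber ρ A + 1 :=
    ENat.lt_add_one_iff h |>.2 le_rfl
  conv_lhs at h1 => rw [Metric.externalCoveringNumber]
  obtain ⟨C, h2⟩ := iInf_lt_iff.1 h1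
  obtain ⟨hC, h3⟩ := iInf_lt_iff.1 h2
  have h4 : C.encard ≤ Metric.externalCoveringNumber ρ A := (ENat.lt_add_one_iff h).1 h3
  have hfin : C.Finite := Set.encard_ne_top_iff.1 (ne_top_of_le_ne_top h h4)
  refine ⟨hfin.toFinset, by simpa using hC, ?_⟩
  rwa [← Set.encard_coe_eq_coe_finsetCard, hfin.coe_toFinset]

namespace Gr

variable {k N : ℕ}

theorem gamma_exists_mem_norm_proj_le_of_covering (h : k ≤ N) (x : EuclideanSpace ℝ (Fin N))
    (A : Set (EuclideanSpace ℝ (Fin N))) {ρ : ℝ≥0} {r : ℝ} (hr : 0 < r)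
    (hA : Metric.externalCoveringNumber ρ A ≠ ⊤) :
    gamma h {V | ∃ y ∈ A, r ≤ dist x y ∧ ‖V.proj (x - y)‖ ≤ ρ} ≤
      ((Metric.externalCoveringNumber ρ A : ℕ∞) : ℝ≥0∞) *
        (smallBallConst N * ENNReal.ofReal (3 * ρ / r) ^ k) := by
  obtain ⟨C, hC, hcard⟩ := exists_finset_isCover hA
  have hsub : {V : Gr k N | ∃ y ∈ A, r ≤ dist x y ∧ ‖V.proj (x - y)‖ ≤ ρ} ⊆
      ⋃ c ∈ C, {V : Gr k N | ∃ y ∈ Metric.closedBall c ρ,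
        r ≤ dist x y ∧ ‖V.proj (x - y)‖ ≤ ρ} := by
    rintro V ⟨y, hy, h1, h2⟩
    obtain ⟨c, hc, hyc⟩ := hC hy
    have hyc' : edist y c ≤ ρ := hyc
    rw [edist_nndist, ENNReal.coe_le_coe] at hyc'
    exact mem_iUnion₂.2 ⟨c, hc, y, hyc', h1, h2⟩
  calc _ ≤ _ := measure_mono hsub
    _ ≤ ∑ c ∈ C, _ := measure_biUnion_finset_le _ _
    _ ≤ ∑ c ∈ C, smallBallConst N * ENNReal.ofReal (3 * ρ / r) ^ k := by
        refine Finset.sum_le_sum fun c _ => ?_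
        have := gamma_exists_mem_norm_proj_le h (x := x) (t := Metric.closedBall c ρ)
          (D := 2 * ρ) (ρ := ρ) (r := r) (by positivity)
          (fun y hy y' hy' => by
            have h1 := dist_triangle_right y y' c
            rw [Metric.mem_closedBall] at hy hy'
            linarith) ρ.2 hr
        rwa [show (ρ : ℝ) + 2 * ρ = 3 * ρ by ring] at this
    _ ≤ _ := by
        rw [Finset.sum_const, nsmul_eq_mul]
        gcongr
        exact_mod_cast hcard

/-- A random fibre through `x` avoids the remainder of `X` if almost surely it avoids the points
of `X` at distance at least `r`, for each `r > 0`. -/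
theorem ae_proj_sub_ne_zero_of_forall (h : k ≤ N) {x : EuclideanSpace ℝ (Fin N)}
    {X : Set (EuclideanSpace ℝ (Fin N))}
    (hX : ∀ r : ℝ, 0 < r → gamma h {V | ∃ y ∈ X, r ≤ dist x y ∧ ‖V.proj (x - y)‖ ≤ 0} = 0) :
    ∀ᵐ V ∂gamma h, ∀ y ∈ X, x ≠ y → V.proj (x - y) ≠ 0 := by
  have h1 : ∀ n : ℕ, ∀ᵐ V ∂gamma h,
      ¬ ∃ y ∈ X, 1 / ((n : ℝ) + 1) ≤ dist x y ∧ ‖V.proj (x - y)‖ ≤ 0 := fun n => by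
    simpa [ae_iff] using hX (1 / ((n : ℝ) + 1)) (by positivity)
  filter_upwards [ae_all_iff.2 h1] with V hV y hy hxy h0
  obtain ⟨n, hn⟩ := exists_nat_one_div_lt (dist_pos.2 hxy)
  exact hV n ⟨y, hy, hn.le, by rw [h0, norm_zero]⟩

theorem ae_proj_sub_ne_zero_of_dimH_lt (h : k ≤ N) (x : EuclideanSpace ℝ (Fin N))
    {X : Set (EuclideanSpace ℝ (Fin N))} (hX : dimH X < (k : ℝ≥0∞)) :
    ∀ᵐ V ∂gamma h, ∀ y ∈ X, x ≠ y → V.proj (x - y) ≠ 0 := by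
  have hH : Measure.hausdorffMeasure (k : ℝ) X = 0 := by
    have := hausdorffMeasure_of_dimH_lt (s := X) (d := (k : ℝ≥0)) (by simpa using hX)
    simpa using this
  refine ae_proj_sub_ne_zero_of_forall h fun r hr => ?_
  set K : ℝ≥0∞ := smallBallConst N * ENNReal.ofReal (1 / r) ^ k with hK
  have hKtop : K ≠ ⊤ := ENNReal.mul_ne_top (smallBallConst_ne_top N) (by simp)
  have hbound : ∀ ε : ℝ≥0∞, 0 < ε →
      gamma h {V | ∃ y ∈ X, r ≤ dist x y ∧ ‖V.proj (x - y)‖ ≤ 0} ≤ K * ε := by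
    intro ε hε
    rw [Measure.hausdorffMeasure_apply] at hH
    have h1 := ENNReal.iSup_eq_zero.1 (ENNReal.iSup_eq_zero.1 hH 1) one_pos
    rw [← h1] at hε
    obtain ⟨t, ht⟩ := iInf_lt_iff.1 hε
    obtain ⟨hXt, ht⟩ := iInf_lt_iff.1 ht
    obtain ⟨hdiam, ht⟩ := iInf_lt_iff.1 ht
    have hsub : {V : Gr k N | ∃ y ∈ X, r ≤ dist x y ∧ ‖V.proj (x - y)‖ ≤ 0} ⊆
        ⋃ n, {V : Gr k N | ∃ y ∈ t n, r ≤ dist x y ∧ ‖V.proj (x - y)‖ ≤ 0} := by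
      rintro V ⟨y, hy, h2⟩
      obtain ⟨n, hn⟩ := mem_iUnion.1 (hXt hy)
      exact mem_iUnion.2 ⟨n, y, hn, h2⟩
    calc _ ≤ _ := measure_mono hsub
      _ ≤ ∑' n, _ := measure_iUnion_le _
      _ ≤ ∑' n, K * ⨆ _ : (t n).Nonempty, Metric.ediam (t n) ^ (k : ℝ) := by
          refine ENNReal.tsum_le_tsum fun n => ?_
          rcases (t n).eq_empty_or_nonempty with hn | hn
          · simp [hn]
          have hfin : Metric.ediam (t n) ≠ ⊤ := ne_top_of_le_ne_top ENNReal.one_ne_top (hdiam n)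
          have h2 := gamma_exists_mem_norm_proj_le h (x := x) (t := t n) (ρ := 0)
            (D := Metric.diam (t n)) Metric.diam_nonneg
            (fun y hy y' hy' => Metric.dist_le_diam_of_mem' hfin hy hy') le_rfl hr
          refine h2.trans (le_of_eq ?_)
          rw [ciSup_pos hn, zero_add, div_eq_mul_one_div, ENNReal.ofReal_mul Metric.diam_nonneg,
            Metric.diam, ENNReal.ofReal_toReal hfin, ENNReal.rpow_natCast, mul_pow, hK]
          ring
      _ = K * _ := ENNReal.tsum_mul_left
      _ ≤ K * ε := by gcongr
  have h2 : Tendsto (fun ε : ℝ≥0∞ => K * ε) (𝓝[>] 0) (𝓝 (K * 0)) :=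
    (ENNReal.Tendsto.const_mul tendsto_id (Or.inr hKtop)).mono_left nhdsWithin_le_nhds
  rw [mul_zero] at h2
  refine le_antisymm (ge_of_tendsto h2 ?_) zero_le
  filter_upwards [self_mem_nhdsWithin] with ε hε using hbound ε hε

theorem ae_proj_sub_ne_zero_of_covering (h : k ≤ N) (x : EuclideanSpace ℝ (Fin N))
    {X : Set (EuclideanSpace ℝ (Fin N))} {M s : ℝ} (hM : 0 ≤ M) (hs : s < k)
    (hX : ∀ᶠ ρ : ℝ≥0 in 𝓝[>] 0, ((Metric.externalCoveringNumber ρ X : ℕ∞) : ℝ≥0∞) ≤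
      ENNReal.ofReal (M * (ρ : ℝ) ^ (-s))) :
    ∀ᵐ V ∂gamma h, ∀ y ∈ X, x ≠ y → V.proj (x - y) ≠ 0 := by
  refine ae_proj_sub_ne_zero_of_forall h fun r hr => ?_
  have hlim : Tendsto (fun ρ : ℝ≥0 => smallBallConst N *
      ENNReal.ofReal (M * (3 / r) ^ k * (ρ : ℝ) ^ ((k : ℝ) - s))) (𝓝[>] 0) (𝓝 0) := by
    have h1 : Tendsto (fun ρ : ℝ≥0 => M * (3 / r) ^ k * (ρ : ℝ) ^ ((k : ℝ) - s)) (𝓝[>] 0)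
        (𝓝 0) := by
      have h2 : Tendsto (fun ρ : ℝ≥0 => (ρ : ℝ) ^ ((k : ℝ) - s)) (𝓝[>] 0) (𝓝 0) := by
        have h3 := (Real.continuousAt_rpow_const (0 : ℝ) ((k : ℝ) - s)
          (Or.inr (sub_pos.2 hs).le)).tendsto
        rw [Real.zero_rpow (sub_pos.2 hs).ne'] at h3
        exact h3.comp ((NNReal.continuous_coe.tendsto' 0 0 rfl).mono_left nhdsWithin_le_nhds)
      simpa using h2.const_mul (M * (3 / r) ^ k)
    have h4 := ENNReal.Tendsto.const_mul (a := smallBallConst N) (ENNReal.tendsto_ofReal h1)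
      (Or.inr (smallBallConst_ne_top N))
    simpa using h4
  refine le_antisymm (ge_of_tendsto hlim ?_) zero_le
  filter_upwards [hX, self_mem_nhdsWithin] with ρ hρ hρ0
  have hρ0' : (0 : ℝ) < ρ := hρ0
  have hfin : Metric.externalCoveringNumber ρ X ≠ ⊤ := by
    intro htop
    rw [htop] at hρ
    simp at hρ
  refine le_trans (measure_mono ?_)
    ((gamma_exists_mem_norm_proj_le_of_covering h x X hr hfin).trans (mul_le_mul_left hρ _))
    |>.trans (le_of_eq ?_)
  · rintro V ⟨y, hy, h1, h2⟩
    exact ⟨y, hy, h1, h2.trans ρ.2⟩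
  · rw [mul_left_comm, ← ENNReal.ofReal_pow (by positivity), ← ENNReal.ofReal_mul (by positivity)]
    congr 2
    rw [div_pow, mul_pow, div_pow, sub_eq_add_neg, Real.rpow_add hρ0', Real.rpow_natCast]
    ring

/-- The covering bound makes `∑ N(X ∩ B(x, r), r ^ (1 / α)) (r ^ (1 / α) / r) ^ k` converge along
`r = 2 ^ (-n)`. By the Borel–Cantelli lemma a random projection then almost surely does not shrink
`x - y` below `‖x - y‖ ^ (1 / α)` for `y ∈ X` near `x`; away from `x` compactness suffices. -/
theorem ae_exists_dist_le_mul_norm_proj_rpow (h : k ≤ N) {x : EuclideanSpace ℝ (Fin N)}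
    {X : Set (EuclideanSpace ℝ (Fin N))} (hXc : IsCompact X) {α M θ : ℝ} (hα : 0 < α)
    (hM : 0 ≤ M) (hθ : 0 < θ)
    (hfib : ∀ᵐ V ∂gamma h, ∀ y ∈ X, x ≠ y → V.proj (x - y) ≠ 0)
    (hX : ∀ᶠ r : ℝ≥0 in 𝓝[>] 0,
      ((Metric.externalCoveringNumber (r ^ (1 / α)) (X ∩ Metric.closedBall x r) : ℕ∞) : ℝ≥0∞) ≤
        ENNReal.ofReal (M * (r : ℝ) ^ (θ - k * (1 / α - 1)))) :
    ∀ᵐ V ∂gamma h, ∃ c : ℝ, ∀ y ∈ X, dist x y ≤ c * ‖V.proj (x - y)‖ ^ α := by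
  set R : ℕ → ℝ≥0 := fun n => (1 / 2) ^ n with hR
  have hRpos : ∀ n, (0 : ℝ) < R n := fun n => by simp only [hR]; positivity
  have hRlim : Tendsto R atTop (𝓝[>] 0) := by
    refine tendsto_nhdsWithin_iff.2 ⟨?_, Eventually.of_forall fun n => hRpos n⟩
    exact tendsto_pow_atTop_nhds_zero_of_lt_one zero_le (by norm_num)
  obtain ⟨n₁, hn₁⟩ := eventually_atTop.1 (hRlim.eventually hX)
  -- `E n` is the event that the exponent `α` fails for some `y` in a dyadic annulus around `x`.
  set E : ℕ → Set (Gr k N) := fun n => {V | ∃ y ∈ X ∩ Metric.closedBall x (R n),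
    (R n : ℝ) / 2 ≤ dist x y ∧ ‖V.proj (x - y)‖ ≤ (R n ^ (1 / α) : ℝ≥0)} with hE
  have hEle : ∀ n, n₁ ≤ n → gamma h (E n) ≤
      smallBallConst N * ENNReal.ofReal (M * 6 ^ k * ((1 / 2 : ℝ) ^ θ) ^ n) := by
    intro n hn
    have hb := hn₁ n hn
    have hfin : Metric.externalCoveringNumber (R n ^ (1 / α))
        (X ∩ Metric.closedBall x (R n)) ≠ ⊤ := by
      intro htop
      rw [htop] at hb
      simp at hb
    refine ((gamma_exists_mem_norm_proj_le_of_covering h x _ (half_pos (hRpos n)) hfin).trans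
      (mul_le_mul_left hb _)).trans (le_of_eq ?_)
    have hRn := hRpos n
    rw [mul_left_comm, ← ENNReal.ofReal_pow (by positivity), ← ENNReal.ofReal_mul (by positivity)]
    congr 2
    have e1 : 3 * ((R n ^ (1 / α) : ℝ≥0) : ℝ) / ((R n : ℝ) / 2) =
        6 * (R n : ℝ) ^ (1 / α - 1) := by
      rw [NNReal.coe_rpow, Real.rpow_sub hRn, Real.rpow_one]
      field_simp
      norm_num
    have e2 : ((1 / 2 : ℝ) ^ θ) ^ n = (R n : ℝ) ^ θ := by
      simp only [hR]
      push_cast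
      rw [← Real.rpow_natCast, ← Real.rpow_natCast, ← Real.rpow_mul (by norm_num),
        ← Real.rpow_mul (by norm_num), mul_comm]
    have e3 : (R n : ℝ) ^ θ =
        (R n : ℝ) ^ (θ - k * (1 / α - 1)) * ((R n : ℝ) ^ (1 / α - 1)) ^ k := by
      rw [← Real.rpow_mul_natCast hRn.le, ← Real.rpow_add hRn]
      congr 1
      ring
    rw [e1, e2, e3, mul_pow]
    ring
  have hsum : ∑' n, gamma h (E (n + n₁)) ≠ ⊤ := by
    refine ne_top_of_le_ne_top ?_
      (ENNReal.tsum_le_tsum fun n => hEle (n + n₁) (Nat.le_add_left _ _))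
    rw [ENNReal.tsum_mul_left]
    refine ENNReal.mul_ne_top (smallBallConst_ne_top N) (Summable.tsum_ofReal_ne_top ?_)
    have hlt : (1 / 2 : ℝ) ^ θ < 1 := Real.rpow_lt_one (by norm_num) (by norm_num) hθ
    have := summable_geometric_of_lt_one (by positivity) hlt
    exact ((summable_nat_add_iff n₁).2 this).mul_left _
  filter_upwards [ae_eventually_notMem hsum, hfib] with V hV hVfib
  obtain ⟨n₂, hn₂⟩ := eventually_atTop.1 hV
  set n₀ := n₂ + n₁ with hn₀
  have hnear : ∀ y ∈ X, x ≠ y → dist x y ≤ R n₀ → dist x y ≤ 1 * ‖V.proj (x - y)‖ ^ α := by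
    intro y hy hxy hle
    have hRn₀ : (R n₀ : ℝ) ≤ 1 := by
      simp only [hR]
      push_cast
      exact pow_le_one₀ (by norm_num) (by norm_num)
    obtain ⟨n, hn1, hn2⟩ := exists_nat_pow_near_of_lt_one (dist_pos.2 hxy) (hle.trans hRn₀)
      (y := (1 / 2 : ℝ)) (by norm_num) (by norm_num)
    have hRn : (R n : ℝ) = (1 / 2 : ℝ) ^ n := by simp [hR]
    have hnn : n₀ < n + 1 := by
      by_contra! hcon
      have h1 : (1 / 2 : ℝ) ^ n₀ ≤ (1 / 2 : ℝ) ^ (n + 1) :=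
        pow_le_pow_of_le_one (by norm_num) (by norm_num) hcon
      have h2 : (R n₀ : ℝ) = (1 / 2 : ℝ) ^ n₀ := by simp [hR]
      linarith
    have hnot : V ∉ E n := by
      have := hn₂ (n - n₁) (by omega)
      rwa [Nat.sub_add_cancel (by omega)] at this
    have hlt : (R n : ℝ) ^ (1 / α) < ‖V.proj (x - y)‖ := by
      by_contra! hcon
      refine hnot ⟨y, ⟨hy, ?_⟩, ?_, by rwa [NNReal.coe_rpow]⟩
      · rw [Metric.mem_closedBall, dist_comm, hRn]
        exact hn2
      · rw [hRn]
        rw [pow_succ] at hn1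
        linarith
    rw [one_mul]
    calc dist x y ≤ R n := hn2.trans_eq hRn.symm
      _ = ((R n : ℝ) ^ (1 / α)) ^ α := by
          rw [← Real.rpow_mul (hRpos n).le, one_div_mul_cancel hα.ne', Real.rpow_one]
      _ ≤ _ := Real.rpow_le_rpow (by positivity) hlt.le hα.le
  have hfar : ∃ c : ℝ, ∀ y ∈ X, R n₀ ≤ dist x y → dist x y ≤ c * ‖V.proj (x - y)‖ ^ α := by
    have hK : IsCompact (X ∩ {y | (R n₀ : ℝ) ≤ dist x y}) :=
      hXc.inter_right (isClosed_le continuous_const (continuous_const.dist continuous_id))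
    have hcont : ContinuousOn (fun y => dist x y / ‖V.proj (x - y)‖ ^ α)
        (X ∩ {y | (R n₀ : ℝ) ≤ dist x y}) := by
      refine ContinuousOn.div (by fun_prop) ?_ ?_
      · exact ContinuousOn.rpow_const (by fun_prop) fun y _ => Or.inr hα.le
      · rintro y ⟨hy, hy'⟩
        have hxy : x ≠ y := dist_pos.1 ((hRpos n₀).trans_le hy')
        exact (Real.rpow_pos_of_pos (norm_pos_iff.2 (hVfib y hy hxy)) α).ne'
    obtain ⟨c, hc⟩ := (hK.image_of_continuousOn hcont).bddAbove
    refine ⟨c, fun y hy hy' => ?_⟩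
    have hxy : x ≠ y := dist_pos.1 ((hRpos n₀).trans_le hy')
    have hpos := Real.rpow_pos_of_pos (norm_pos_iff.2 (hVfib y hy hxy)) α
    exact (div_le_iff₀ hpos).1 (hc ⟨y, ⟨hy, hy'⟩, rfl⟩)
  obtain ⟨c, hc⟩ := hfar
  refine ⟨max 1 c, fun y hy => ?_⟩
  have hnn : 0 ≤ ‖V.proj (x - y)‖ ^ α := by positivity
  rcases eq_or_ne x y with rfl | hxy
  · rw [dist_self]
    positivity
  rcases le_total (dist x y) (R n₀) with hle | hle
  · exact (hnear y hy hxy hle).trans (mul_le_mul_of_nonneg_right (le_max_left _ _) hnn)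
  · exact (hc y hy hle).trans (mul_le_mul_of_nonneg_right (le_max_right _ _) hnn)

end Gr

/-! ### From almost every projection for each point to almost every point for each projection -/

namespace Gr

variable {k N : ℕ}

/-- By compactness, if the fibre of `P_V` through `x` contains no other point of `X`, then points
`y ∈ X` with `P_V y` close to `P_V x` are close to `x`. -/
theorem exists_dist_le_or_le_norm_proj {X : Set (EuclideanSpace ℝ (Fin N))} (hXc : IsCompact X)
    {x : EuclideanSpace ℝ (Fin N)} {V : Gr k N} (hV : ∀ y ∈ X, x ≠ y → V.proj (x - y) ≠ 0)
    (n : ℕ) : ∃ m : ℕ, ∀ y ∈ X,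
      dist x y ≤ 1 / ((n : ℝ) + 1) ∨ 1 / ((m : ℝ) + 1) ≤ ‖V.proj (x - y)‖ := by
  have hn : (0 : ℝ) < 1 / ((n : ℝ) + 1) := by positivity
  have hK : IsCompact (X ∩ {y | 1 / ((n : ℝ) + 1) ≤ dist x y}) :=
    hXc.inter_right (isClosed_le continuous_const (continuous_const.dist continuous_id))
  obtain ⟨δ, hδ, hδ'⟩ := hK.exists_forall_le' (f := fun y => ‖V.proj (x - y)‖) (a := 0)
    (by fun_prop) fun y hy => norm_pos_iff.2 (hV y hy.1 (dist_pos.1 (hn.trans_le hy.2)))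
  obtain ⟨m, hm⟩ := exists_nat_one_div_lt hδ
  refine ⟨m, fun y hy => ?_⟩
  rcases le_total (dist x y) (1 / ((n : ℝ) + 1)) with h | h
  · exact Or.inl h
  · exact Or.inr (hm.le.trans (hδ' y ⟨hy, h⟩))

theorem dist_proj (V : Gr k N) (x y : EuclideanSpace ℝ (Fin N)) :
    dist (V.proj x) (V.proj y) = ‖V.proj (x - y)‖ := by
  rw [dist_eq_norm, map_sub]

/-- A Fubini argument: a measurable property of pairs `(x, V)` that holds, for each `x ∈ X`, for
almost every `V` holds, for almost every `V`, on a Borel subset of `X` of full measure. -/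
theorem ae_exists_measurableSet_subset (h : k ≤ N) {X : Set (EuclideanSpace ℝ (Fin N))}
    (hXm : MeasurableSet X) {μ : Measure (EuclideanSpace ℝ (Fin N))} [IsFiniteMeasure μ]
    (hμ : μ Xᶜ = 0) {T : Set (EuclideanSpace ℝ (Fin N) × Gr k N)} (hT : MeasurableSet T)
    (hXT : ∀ x ∈ X, ∀ᵐ V ∂gamma h, (x, V) ∈ T) :
    ∀ᵐ V ∂gamma h, ∃ S ⊆ X, MeasurableSet S ∧ μ Sᶜ = 0 ∧ ∀ x ∈ S, (x, V) ∈ T := by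
  have hX : ∀ᵐ x ∂μ, x ∈ X := hμ
  have h1 : ∀ᵐ x ∂μ, ∀ᵐ V ∂gamma h, (x, V) ∈ T := hX.mono hXT
  have h2 : ∀ᵐ V ∂gamma h, ∀ᵐ x ∂μ, (x, V) ∈ T :=
    (Measure.ae_ae_comm (p := fun x V => (x, V) ∈ T) hT).1 h1
  filter_upwards [h2] with V hV
  exact ⟨X ∩ (fun x => (x, V)) ⁻¹' T, inter_subset_left, hXm.inter (measurable_prodMk_right hT),
    hX.and hV, fun x hx => hx.2⟩

theorem continuous_norm_proj_sub (y : EuclideanSpace ℝ (Fin N)) :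
    Continuous fun p : EuclideanSpace ℝ (Fin N) × Gr k N => ‖p.2.proj (p.1 - y)‖ := by
  simp only [norm_proj]
  have h : Continuous fun V : Gr k N => V.1.starProjection := continuous_induced_dom
  exact ((h.comp continuous_snd).clm_apply (continuous_fst.sub continuous_const)).norm

theorem ae_exists_continuousOn_inverse (h : k ≤ N) {X : Set (EuclideanSpace ℝ (Fin N))}
    (hXc : IsCompact X) {μ : Measure (EuclideanSpace ℝ (Fin N))} [IsFiniteMeasure μ]
    (hμ : μ Xᶜ = 0) (hfib : ∀ x ∈ X, ∀ᵐ V ∂gamma h, ∀ y ∈ X, x ≠ y → V.proj (x - y) ≠ 0) :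
    ∀ᵐ V : Gr k N ∂gamma h, ∃ S : Set (EuclideanSpace ℝ (Fin N)),
      S ⊆ X ∧ MeasurableSet S ∧ μ Sᶜ = 0 ∧ InjOn V.proj S ∧
        ContinuousOn (Function.invFunOn V.proj S) (V.proj '' S) := by
  -- The quantitative form of the condition on fibres is visibly Borel in `(x, V)`.
  set T : Set (EuclideanSpace ℝ (Fin N) × Gr k N) := ⋂ n : ℕ, ⋃ m : ℕ, ⋂ y ∈ X,
    ({p | dist p.1 y ≤ 1 / ((n : ℝ) + 1)} ∪ {p | 1 / ((m : ℝ) + 1) ≤ ‖p.2.proj (p.1 - y)‖})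
    with hT
  have hTm : MeasurableSet T := by
    refine MeasurableSet.iInter fun n => MeasurableSet.iUnion fun m => IsClosed.measurableSet ?_
    refine isClosed_biInter fun y _ => IsClosed.union ?_ ?_
    · exact isClosed_le (continuous_fst.dist continuous_const) continuous_const
    · exact isClosed_le continuous_const (continuous_norm_proj_sub y)
  have hTmem : ∀ x V, (x, V) ∈ T ↔ ∀ n : ℕ, ∃ m : ℕ, ∀ y ∈ X,
      dist x y ≤ 1 / ((n : ℝ) + 1) ∨ 1 / ((m : ℝ) + 1) ≤ ‖V.proj (x - y)‖ := fun x V => by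
    simp only [hT, mem_iInter, mem_iUnion, mem_union, mem_ofPred_eq]
  have hXT : ∀ x ∈ X, ∀ᵐ V ∂gamma h, (x, V) ∈ T := fun x hx => by
    filter_upwards [hfib x hx] with V hV
    exact (hTmem x V).2 fun n => exists_dist_le_or_le_norm_proj hXc hV n
  filter_upwards [ae_exists_measurableSet_subset h hXc.measurableSet hμ hTm hXT]
    with V ⟨S, hSX, hSm, hS0, hS⟩
  have hinj : InjOn V.proj S := by
    intro x hx y hy hxy
    by_contra hne
    obtain ⟨n, hn⟩ := exists_nat_one_div_lt (dist_pos.2 hne)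
    obtain ⟨m, hm⟩ := (hTmem x V).1 (hS x hx) n
    rcases hm y (hSX hy) with h1 | h1
    · exact h1.not_gt hn
    · rw [← dist_proj, hxy, dist_self] at h1
      exact h1.not_gt (by positivity)
  refine ⟨S, hSX, hSm, hS0, hinj, ?_⟩
  rintro _ ⟨x, hx, rfl⟩
  rw [Metric.continuousWithinAt_iff]
  intro ε hε
  obtain ⟨n, hn⟩ := exists_nat_one_div_lt hε
  obtain ⟨m, hm⟩ := (hTmem x V).1 (hS x hx) n
  refine ⟨1 / ((m : ℝ) + 1), by positivity, ?_⟩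
  rintro _ ⟨y, hy, rfl⟩ hd
  rw [hinj.leftInvOn_invFunOn hx, hinj.leftInvOn_invFunOn hy, dist_comm]
  rw [dist_comm, dist_proj] at hd
  exact ((hm y (hSX hy)).resolve_right hd.not_ge).trans_lt hn

theorem ae_exists_pointwiseHolderOn_inverse (h : k ≤ N) {X : Set (EuclideanSpace ℝ (Fin N))}
    (hXc : IsCompact X) {μ : Measure (EuclideanSpace ℝ (Fin N))} [IsFiniteMeasure μ]
    (hμ : μ Xᶜ = 0) {b : EReal} (hb : 0 < b)
    (hhol : ∀ α : ℝ, 0 < α → (α : EReal) < b → ∀ x ∈ X, ∀ᵐ V ∂gamma h,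
      ∃ c : ℝ, ∀ y ∈ X, dist x y ≤ c * ‖V.proj (x - y)‖ ^ α) :
    ∀ᵐ V : Gr k N ∂gamma h, ∃ S : Set (EuclideanSpace ℝ (Fin N)),
      S ⊆ X ∧ MeasurableSet S ∧ μ Sᶜ = 0 ∧ InjOn V.proj S ∧
        ∀ α : ℝ, 0 < α → (α : EReal) < b →
          PointwiseHolderOn α (Function.invFunOn V.proj S) (V.proj '' S) := by
  -- Only the countably many rational exponents are needed; the set of pairs with a given exponent
  -- and a given constant is closed.
  set T : Set (EuclideanSpace ℝ (Fin N) × Gr k N) :=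
    ⋂ q : {q : ℚ // 0 < (q : ℝ) ∧ ((q : ℝ) : EReal) < b}, ⋃ c : ℕ, ⋂ y ∈ X,
      {p | dist p.1 y ≤ c * ‖p.2.proj (p.1 - y)‖ ^ ((q : ℚ) : ℝ)} with hT
  have hTm : MeasurableSet T := by
    refine MeasurableSet.iInter fun q => MeasurableSet.iUnion fun c => IsClosed.measurableSet ?_
    refine isClosed_biInter fun y _ =>
      isClosed_le (continuous_fst.dist continuous_const) (continuous_const.mul ?_)
    exact (continuous_norm_proj_sub y).rpow_const fun _ => Or.inr q.2.1.le
  have hTmem : ∀ x V, (x, V) ∈ T ↔ ∀ q : {q : ℚ // 0 < (q : ℝ) ∧ ((q : ℝ) : EReal) < b},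
      ∃ c : ℕ, ∀ y ∈ X, dist x y ≤ c * ‖V.proj (x - y)‖ ^ ((q : ℚ) : ℝ) := fun x V => by
    simp only [hT, mem_iInter, mem_iUnion, mem_ofPred_eq]
  have hXT : ∀ x ∈ X, ∀ᵐ V ∂gamma h, (x, V) ∈ T := fun x hx => by
    filter_upwards [ae_all_iff.2 fun q : {q : ℚ // 0 < (q : ℝ) ∧ ((q : ℝ) : EReal) < b} =>
      hhol q q.2.1 q.2.2 x hx] with V hV
    refine (hTmem x V).2 fun q => ?_
    obtain ⟨c, hc⟩ := hV q
    obtain ⟨m, hm⟩ := exists_nat_ge c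
    exact ⟨m, fun y hy => (hc y hy).trans (mul_le_mul_of_nonneg_right hm (by positivity))⟩
  have hrat : ∀ α : ℝ, (α : EReal) < b → ∃ q : ℚ, α < q ∧ ((q : ℝ) : EReal) < b := by
    intro α hαb
    obtain ⟨β, hαβ, hβb⟩ := EReal.lt_iff_exists_real_btwn.1 hαb
    obtain ⟨q, hq1, hq2⟩ := exists_rat_btwn (EReal.coe_lt_coe_iff.1 hαβ)
    exact ⟨q, hq1, (EReal.coe_lt_coe_iff.2 hq2).trans hβb⟩
  filter_upwards [ae_exists_measurableSet_subset h hXc.measurableSet hμ hTm hXT]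
    with V ⟨S, hSX, hSm, hS0, hS⟩
  have hinj : InjOn V.proj S := by
    intro x hx y hy hxy
    obtain ⟨q, hq0, hqb⟩ := hrat 0 (by simpa using hb)
    obtain ⟨c, hc⟩ := (hTmem x V).1 (hS x hx) ⟨q, hq0, hqb⟩
    have h1 := hc y (hSX hy)
    rw [← dist_proj, hxy, dist_self, Real.zero_rpow hq0.ne', mul_zero] at h1
    exact dist_le_zero.1 h1
  refine ⟨S, hSX, hSm, hS0, hinj, fun α hα hαb => ?_⟩
  rintro _ ⟨x, hx, rfl⟩
  obtain ⟨q, hq0, hqb⟩ := hrat α hαb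
  obtain ⟨c, hc⟩ := (hTmem x V).1 (hS x hx) ⟨q, hα.trans hq0, hqb⟩
  have hdiam := hXc.isBounded
  set D := Metric.diam X with hD
  have hD0 : 0 ≤ D := Metric.diam_nonneg
  refine ⟨c * D ^ ((q : ℝ) - α) + 1, by positivity, ?_⟩
  rintro _ ⟨y, hy, rfl⟩
  rw [hinj.leftInvOn_invFunOn hx, hinj.leftInvOn_invFunOn hy, dist_proj]
  have hPD : ‖V.proj (x - y)‖ ≤ D := (V.norm_proj_le _).trans
    (dist_eq_norm x y ▸ Metric.dist_le_diam_of_mem hdiam (hSX hx) (hSX hy))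
  -- A larger exponent is stronger because `X` is bounded.
  have hsplit : ‖V.proj (x - y)‖ ^ (q : ℝ) ≤ D ^ ((q : ℝ) - α) * ‖V.proj (x - y)‖ ^ α := by
    calc ‖V.proj (x - y)‖ ^ (q : ℝ)
        = ‖V.proj (x - y)‖ ^ ((q : ℝ) - α) * ‖V.proj (x - y)‖ ^ α := by
          rw [← Real.rpow_add_of_nonneg (norm_nonneg _) (sub_pos.2 hq0).le hα.le, sub_add_cancel]
      _ ≤ _ := by
          gcongr
  have hnn : 0 ≤ ‖V.proj (x - y)‖ ^ α := by positivity
  calc dist x y ≤ c * ‖V.proj (x - y)‖ ^ (q : ℝ) := hc y (hSX hy)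
    _ ≤ c * (D ^ ((q : ℝ) - α) * ‖V.proj (x - y)‖ ^ α) := by gcongr
    _ ≤ (c * D ^ ((q : ℝ) - α) + 1) * ‖V.proj (x - y)‖ ^ α := by nlinarith

end Gr

/-! ### Covering numbers from dimension bounds -/

namespace Dimension

theorem eventually_externalCoveringNumber_le {Z : Type*} [PseudoMetricSpace Z] {X : Set Z}
    {s : ℝ} (hs : upperBoxDim X < (s : EReal)) :
    ∀ᶠ ρ : ℝ≥0 in 𝓝[>] 0, ((Metric.externalCoveringNumber ρ X : ℕ∞) : ℝ≥0∞) ≤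
      ENNReal.ofReal ((ρ : ℝ) ^ (-s)) := by
  have h1 : ∀ᶠ ρ : ℝ≥0 in 𝓝[>] 0, ρ < 1 :=
    mem_nhdsWithin_of_mem_nhds (Iio_mem_nhds one_pos)
  filter_upwards [eventually_lt_of_limsup_lt hs, h1, self_mem_nhdsWithin] with ρ hρ hρ1 hρ0
  have hρ0' : (0 : ℝ) < ρ := hρ0
  have hL : 0 < -Real.log ρ := neg_pos.2 (Real.log_neg hρ0' hρ1)
  rw [EReal.div_lt_iff (by exact_mod_cast hL) (EReal.coe_ne_top _)] at hρ
  rw [← ENNReal.exp_log ((Metric.externalCoveringNumber ρ X : ℕ∞) : ℝ≥0∞)]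
  refine (EReal.exp_monotone hρ.le).trans (le_of_eq ?_)
  rw [← EReal.coe_mul, EReal.exp_coe, Real.rpow_def_of_pos hρ0']
  congr 2
  ring

theorem exists_isHomogeneous_of_assouadDim_lt {Z : Type*} [PseudoMetricSpace Z] {X : Set Z}
    {d : ℝ≥0} (h : assouadDim X < (d : ℝ≥0∞)) : ∃ M s : ℝ≥0, s < d ∧ IsHomogeneous M s X := by
  obtain ⟨s, hs⟩ := iInf_lt_iff.1 h
  obtain ⟨⟨-, M, -, hM⟩, hsd⟩ := iInf_lt_iff.1 hs
  exact ⟨M, s, by exact_mod_cast hsd, hM⟩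

theorem IsHomogeneous.externalCoveringNumber_le {Z : Type*} [PseudoMetricSpace Z] {X : Set Z}
    {M s : ℝ≥0} (h : IsHomogeneous M s X) {x : Z} (hx : x ∈ X) {r ρ : ℝ≥0} (hρ : 0 < ρ)
    (hρr : ρ < r) :
    ((Metric.externalCoveringNumber ρ (X ∩ Metric.closedBall x r) : ℕ∞) : ℝ≥0∞) ≤
      ENNReal.ofReal (M * (r : ℝ) ^ (s : ℝ) * (ρ : ℝ) ^ (-(s : ℝ))) := by
  refine (h x hx r ρ hρ hρr).trans (le_of_eq ?_)
  rw [← ENNReal.ofReal_coe_nnreal]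
  congr 1
  push_cast
  rw [Real.div_rpow r.coe_nonneg ρ.coe_nonneg, Real.rpow_neg ρ.coe_nonneg]
  ring

end Dimension

/-! ### Almost sure Hölder bounds from the box and Assouad dimensions -/

theorem tendsto_nnreal_rpow_nhdsGT_zero {p : ℝ} (hp : 0 < p) :
    Tendsto (fun r : ℝ≥0 => r ^ p) (𝓝[>] 0) (𝓝[>] 0) := by
  refine tendsto_nhdsWithin_iff.2 ⟨?_, ?_⟩
  · have := (NNReal.continuousAt_rpow_const (x := 0) (y := p) (Or.inr hp.le)).tendsto
    rw [NNReal.zero_rpow hp.ne'] at this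
    exact this.mono_left nhdsWithin_le_nhds
  · filter_upwards [self_mem_nhdsWithin] with r hr using NNReal.rpow_pos hr

theorem lt_mul_one_sub_of_lt_one_sub_div {d : EReal} {k : ℕ} (hk : 1 ≤ k) {α : ℝ}
    (hd : d < (k : EReal)) (hα : (α : EReal) < 1 - d / (k : EReal)) :
    d < ((k * (1 - α) : ℝ) : EReal) := by
  have hk0 : (0 : ℝ) < k := by exact_mod_cast hk
  induction d with
  | bot => exact EReal.bot_lt_coe _
  | top => exact absurd hd not_top_lt
  | coe d =>
    have h1 : (1 : EReal) - (d : EReal) / (k : EReal) = ((1 - d / k : ℝ) : EReal) := by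
      rw [EReal.coe_sub, EReal.coe_div]
      rfl
    rw [h1, EReal.coe_lt_coe_iff] at hα
    rw [EReal.coe_lt_coe_iff]
    have h2 : d / k < 1 - α := by linarith
    rwa [div_lt_iff₀' hk0] at h2

namespace Gr

variable {k N : ℕ}

theorem ae_exists_holder_of_upperBoxDim (h : k ≤ N) {X : Set (EuclideanSpace ℝ (Fin N))}
    (hXc : IsCompact X) (hk : 1 ≤ k) (hd : Dimension.upperBoxDim X < (k : EReal)) {α : ℝ}
    (hα : 0 < α) (hαd : (α : EReal) < 1 - Dimension.upperBoxDim X / (k : EReal))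
    (x : EuclideanSpace ℝ (Fin N)) :
    ∀ᵐ V ∂gamma h, ∃ c : ℝ, ∀ y ∈ X, dist x y ≤ c * ‖V.proj (x - y)‖ ^ α := by
  obtain ⟨s, hds, hsk⟩ := EReal.lt_iff_exists_real_btwn.1
    (lt_mul_one_sub_of_lt_one_sub_div hk hd hαd)
  have hsk' : s < k * (1 - α) := EReal.coe_lt_coe_iff.1 hsk
  have hk0 : (0 : ℝ) < k := by exact_mod_cast hk
  have hcov := Dimension.eventually_externalCoveringNumber_le hds
  have hfib := ae_proj_sub_ne_zero_of_covering h x (X := X) (M := 1) (s := s) zero_le_one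
    (by nlinarith) (by simpa only [one_mul] using hcov)
  refine ae_exists_dist_le_mul_norm_proj_rpow h hXc hα (M := 1)
    (θ := (k * (1 - α) - s) / α) zero_le_one (div_pos (sub_pos.2 hsk') hα) hfib ?_
  filter_upwards [(tendsto_nnreal_rpow_nhdsGT_zero (one_div_pos.2 hα)).eventually hcov] with r hr
  refine le_trans ?_ (hr.trans (le_of_eq ?_))
  · exact_mod_cast Metric.externalCoveringNumber_mono_set inter_subset_left
  · rw [NNReal.coe_rpow, ← Real.rpow_mul r.coe_nonneg, one_mul]
    congr 2
    field_simp
    ring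

theorem ae_exists_holder_of_assouadDim (h : k ≤ N) {X : Set (EuclideanSpace ℝ (Fin N))}
    (hXc : IsCompact X) (hd : Dimension.assouadDim X < (k : ℝ≥0∞)) {α : ℝ}
    (hα : 0 < α) (hα1 : α < 1) {x : EuclideanSpace ℝ (Fin N)} (hx : x ∈ X) :
    ∀ᵐ V ∂gamma h, ∃ c : ℝ, ∀ y ∈ X, dist x y ≤ c * ‖V.proj (x - y)‖ ^ α := by
  obtain ⟨M, s, hsk, hM⟩ := Dimension.exists_isHomogeneous_of_assouadDim_lt (d := (k : ℝ≥0))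
    (by simpa using hd)
  have hsk' : (s : ℝ) < k := by exact_mod_cast hsk
  have hα' : 0 < 1 / α - 1 := sub_pos.2 ((one_lt_div hα).2 hα1)
  obtain ⟨R, hR0, hR⟩ := hXc.isBounded.subset_closedBall_lt 0 x
  lift R to ℝ≥0 using hR0.le
  have hfib := ae_proj_sub_ne_zero_of_covering h x (X := X) (M := M * (R : ℝ) ^ (s : ℝ)) (s := s)
    (by positivity) hsk' (by
      have h1 : ∀ᶠ ρ : ℝ≥0 in 𝓝[>] 0, ρ < R :=
        mem_nhdsWithin_of_mem_nhds (Iio_mem_nhds (by exact_mod_cast hR0))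
      filter_upwards [h1, self_mem_nhdsWithin] with ρ hρR hρ0
      have h2 := hM.externalCoveringNumber_le hx hρ0 hρR
      rwa [inter_eq_left.2 hR] at h2)
  refine ae_exists_dist_le_mul_norm_proj_rpow h hXc hα (M := M)
    (θ := (k - s) * (1 / α - 1)) M.coe_nonneg (mul_pos (sub_pos.2 hsk') hα') hfib ?_
  have h1 : ∀ᶠ r : ℝ≥0 in 𝓝[>] 0, r < 1 := mem_nhdsWithin_of_mem_nhds (Iio_mem_nhds one_pos)
  filter_upwards [h1, self_mem_nhdsWithin] with r hr1 hr0
  have hr0' : (0 : ℝ) < r := hr0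
  have hlt : r ^ (1 / α) < r := by
    simpa using NNReal.rpow_lt_rpow_of_exponent_gt hr0 hr1 ((one_lt_div hα).2 hα1)
  refine (hM.externalCoveringNumber_le hx (NNReal.rpow_pos hr0) hlt).trans (le_of_eq ?_)
  rw [NNReal.coe_rpow, ← Real.rpow_mul r.coe_nonneg, mul_assoc, ← Real.rpow_add hr0']
  congr 3
  ring

end Gr

theorem mainTheorem2 (k N : ℕ) (hk : 1 ≤ k) (hkN : k ≤ N)
    (X : Set (EuclideanSpace ℝ (Fin N))) (hX : IsCompact X)
    (μ : Measure (EuclideanSpace ℝ (Fin N))) [IsFiniteMeasure μ] (hμ : μ Xᶜ = 0) :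
    (dimH X < (k : ℝ≥0∞) →
      ∀ᵐ V : Gr k N ∂(Gr.gamma hkN), ∃ S : Set (EuclideanSpace ℝ (Fin N)),
        S ⊆ X ∧ MeasurableSet S ∧ μ Sᶜ = 0 ∧ InjOn V.proj S ∧
          ContinuousOn (Function.invFunOn V.proj S) (V.proj '' S)) ∧
    (Dimension.upperBoxDim X < (k : EReal) →
      ∀ᵐ V : Gr k N ∂(Gr.gamma hkN), ∃ S : Set (EuclideanSpace ℝ (Fin N)),
        S ⊆ X ∧ MeasurableSet S ∧ μ Sᶜ = 0 ∧ InjOn V.proj S ∧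
          ∀ α : ℝ, 0 < α → (α : EReal) < 1 - Dimension.upperBoxDim X / (k : EReal) →
            PointwiseHolderOn α (Function.invFunOn V.proj S) (V.proj '' S)) ∧
    (Dimension.assouadDim X < (k : ℝ≥0∞) →
      ∀ᵐ V : Gr k N ∂(Gr.gamma hkN), ∃ S : Set (EuclideanSpace ℝ (Fin N)),
        S ⊆ X ∧ MeasurableSet S ∧ μ Sᶜ = 0 ∧ InjOn V.proj S ∧
          ∀ α : ℝ, 0 < α → α < 1 →
            PointwiseHolderOn α (Function.invFunOn V.proj S) (V.proj '' S)) := by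
  refine ⟨fun hd => ?_, fun hd => ?_, fun hd => ?_⟩
  · exact Gr.ae_exists_continuousOn_inverse hkN hX hμ fun x _ =>
      Gr.ae_proj_sub_ne_zero_of_dimH_lt hkN x hd
  · have hb : 0 < 1 - Dimension.upperBoxDim X / (k : EReal) := by
      have hk0 : (0 : EReal) < (k : EReal) := by exact_mod_cast hk
      rw [EReal.sub_pos, EReal.div_lt_iff hk0 (EReal.natCast_ne_top k), one_mul]
      exact hd
    exact Gr.ae_exists_pointwiseHolderOn_inverse hkN hX hμ hb fun α hα hαd x _ =>
      Gr.ae_exists_holder_of_upperBoxDim hkN hX hk hd hα hαd x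
  · have hmain := Gr.ae_exists_pointwiseHolderOn_inverse hkN hX hμ (b := 1) one_pos
      fun α hα hα1 x hx => Gr.ae_exists_holder_of_assouadDim hkN hX hd hα
        (by exact_mod_cast hα1) hx
    filter_upwards [hmain] with V ⟨S, hSX, hSm, hS0, hinj, hS⟩
    exact ⟨S, hSX, hSm, hS0, hinj, fun α hα hα1 => hS α hα (by exact_mod_cast hα1)⟩
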